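/- **Setting.** An $\mathfrak{sl}_n$ rigged configuration $\mathrm{RC}=((\mu^{(0)}_i),(\mu^{(1)}_i,r^{(1)}_i),\dots,(\mu^{(n-1)}_i,r^{(n-1)}_i))$ consists of finite sequences of rows of positive widths $\mu^{(a)}_i$ and integers $r^{(a)}_i$ ("riggings", $1\le a\le n-1$) with $0\le r^{(a)}_i\le p^{(a)}_{\mu_i^{(a)}}$, where $Q^{(a)}_j=\sum_k\min(j,\mu^{(a)}_k)$ (and $Q^{(n)}_j=0$) and the vacancy number is $p^{(a)}_j=Q^{(a-1)}_j-2Q^{(a)}_j+Q^{(a+1)}_j$. A row of $\mu^{(a)}$, $a\ge1$, is *singular* if its rigging equals the vacancy number at its width. $\mu^{(0)}$ is called the quantum space. *KKR procedure.* To remove the rightmost box $\alpha^{(0)}$ of a row of the quantum space, choose successively boxes $\alpha^{(a)}\in\mu^{(a)}$, $a=1,2,\dots$: among the singular rows of $\mu^{(a)}$ of width at least the column of $\alpha^{(a-1)}$ take a shortest one, and let $\alpha^{(a)}$ be its rightmost box; if there is none, the choice ends and no box is taken at the levels $\ge a$. Then delete all chosen boxes and give each shortened row its new vacancy number as rigging,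 while all other rows keep their riggings. The step produces the letter $j=1+\max\{k:\alpha^{(k)}\text{ was chosen}\}$. Removing a row means removing all its boxes from right to left; the letters are recorded in this order. *Normal ordering.* Replace the quantum space by $\mu^{(0)}\cup\mu^{(1)}\cup(1^L)$, with $L$ so large that no row of $\mu^{(1)}$ is singular at any moment when a box of the part $\mu^{(0)}$ is about to be removed, and remove first all the rows of the part $\mu^{(0)}$, in any order. Then remove boxes of the part $(1^L)$ one by one until some row of $\mu^{(1)}$ is singular, choose a singular row $A$ of $\mu^{(1)}$ and remove the corresponding row (of the same width $|A|$) of the part $\mu^{(1)}$ of the quantum space. Next, again remove boxes of $(1^L)$ until some row of $\mu^{(1)}$ is singular, choose a singular row $B$ of $\mu^{(1)}$ and remove the corresponding row (of the same width $|B|$) of the part $\mu^{(1)}$ of the quantum space. We say that row $A$ is removed and then row $B$ is removed. **Proposition 5.1.** In this setting, let $m$ be the number of boxes in columns $\le|B|$ that are removed from $\mu^{(2)}$ during the removal of $A$, let $a_1,\dots,a_m$ be the letters produced by the corresponding steps, in this order, and let $b_1,\dots,b_{|B|}$ be the letters produced by the removal of $B$, in this order. Then $m\le|B|$, $a_1\le\dots\le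 a_m$, $b_1\le\dots\le b_{|B|}$, and $$b_i<a_i\qquad(1\le i\le m).$$ In particular, joining for $1\le i\le m$ the box of the one-row tableau $B$ that carries $b_i$ with the box of the one-row tableau $A$ that carries $a_i$ gives a system of $m$ unwinding pairs of $B\otimes A$: each box is joined at most once, and in each pair the letter in $B$ is strictly smaller than the letter in $A$. -/

import Mathlib

/-- Data `(μ^(a)_i, r^(a)_i)` of sequences of rows with riggings.  `ι a` labels the rows of `μ^(a)`;
`width a i` is the width of row `i` of `μ^(a)`, and `rigging a i` is its rigging (it is not used at
level `a = 0`, the quantum space).  During the box removing procedure a row may shrink to width `0`,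
which means that it is no longer there. -/
@[ext]
structure RCData (ι : ℕ → Type) where
  width : ∀ a, ι a → ℕ
  rigging : ∀ a, ι a → ℤ

namespace RCData

section General

variable {ι : ℕ → Type} [∀ a, Fintype (ι a)]

/-- `Q^(a)_j = ∑_i min (j, μ^(a)_i)`, the number of boxes of `μ^(a)` in columns `≤ j`. -/
def Q (S : RCData ι) (a j : ℕ) : ℤ :=
  ∑ i : ι a, ((min j (S.width a i) : ℕ) : ℤ)

/-- The vacancy number `p^(a)_j = Q^(a-1)_j - 2 Q^(a)_j + Q^(a+1)_j` (meaningful for `a ≥ 1`). -/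
def vacancy (S : RCData ι) (a j : ℕ) : ℤ :=
  S.Q (a - 1) j - 2 * S.Q a j + S.Q (a + 1) j

/-- A row (that is still there) is singular when its rigging equals its vacancy number. -/
def Singular (S : RCData ι) (a : ℕ) (i : ι a) : Prop :=
  0 < S.width a i ∧ S.rigging a i = S.vacancy a (S.width a i)

/-- `S` is an `𝔰𝔩ₙ` rigged configuration: the levels are `0, …, n - 1`, all rows are nonempty, and
`0 ≤ r^(a)_i ≤ p^(a)_{μ^(a)_i}` for `1 ≤ a ≤ n - 1` (in particular these vacancy numbers
are nonnegative). -/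
structure IsRiggedConfiguration (n : ℕ) (S : RCData ι) : Prop where
  isEmpty_of_le : ∀ a, n ≤ a → IsEmpty (ι a)
  width_pos : ∀ a (i : ι a), 0 < S.width a i
  rigging_nonneg : ∀ a, 1 ≤ a → ∀ i : ι a, 0 ≤ S.rigging a i
  rigging_le : ∀ a, 1 ≤ a → ∀ i : ι a, S.rigging a i ≤ S.vacancy a (S.width a i)

/-- `α` is an admissible choice of boxes when the rightmost box of the row `i₀` of the
quantum space is removed.  `α a = some i` means that the rightmost box of the row `i` of `μ^(a)` is
chosen (its column is the width of the row), `α a = none` that no box of `μ^(a)` is chosen.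
If a box in column `c` of `μ^(a)` is chosen, then in `μ^(a+1)` one chooses a shortest
row among the singular rows of width `≥ c`; if there is no such row, the selection stops. -/
structure IsSelection (S : RCData ι) (i₀ : ι 0) (α : ∀ a, Option (ι a)) : Prop where
  zero : α 0 = some i₀
  next_singular : ∀ a i i', α a = some i → α (a + 1) = some i' →
    S.Singular (a + 1) i' ∧ S.width a i ≤ S.width (a + 1) i'
  next_shortest : ∀ a i i', α a = some i → α (a + 1) = some i' →
    ∀ i'', S.Singular (a + 1) i'' → S.width a i ≤ S.width (a + 1) i'' →
      S.width (a + 1) i' ≤ S.width (a + 1) i''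
  exhausted : ∀ a i, α a = some i → α (a + 1) = none →
    ∀ i'', S.Singular (a + 1) i'' → S.width (a + 1) i'' < S.width a i
  none_succ : ∀ a, α a = none → α (a + 1) = none

/-- The letter produced by a choice of boxes: the index of the first level at which no
box is chosen, i.e. `1 + max {k | a box of μ^(k) is chosen}`. -/
noncomputable def letter (α : ∀ a, Option (ι a)) : ℕ :=
  sInf {j : ℕ | α j = none}

open Classical in
/-- Take the chosen boxes away, keeping the riggings. -/
noncomputable def shrink (S : RCData ι) (α : ∀ a, Option (ι a)) : RCData ι where
  width a i := if α a = some i then S.width a i - 1 else S.width a i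
  rigging := S.rigging

open Classical in
/-- Remove the chosen boxes: a row that lost a box gets its new vacancy number
as its rigging, and all other rows keep their riggings. -/
noncomputable def remove (S : RCData ι) (α : ∀ a, Option (ι a)) : RCData ι where
  width := (S.shrink α).width
  rigging a i :=
    if α a = some i then (S.shrink α).vacancy a ((S.shrink α).width a i) else S.rigging a i

/-- `S'` results from `S` by one step of the KKR procedure: the removal of the rightmost box of the
row `i₀` of the quantum space together with the boxes chosen by `α`. -/
def KKRStep (S : RCData ι) (i₀ : ι 0) (α : ∀ a, Option (ι a)) (S' : RCData ι) : Prop :=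
  0 < S.width 0 i₀ ∧ S.IsSelection i₀ α ∧ S' = S.remove α

/-- `T 0, T 1, …, T w` are the successive data while the row `i₀` of the quantum space, of
width `w`, is removed box by box (from right to left) by the KKR procedure; `α k` is the
choice of boxes made at the `k`-th removal (counted from `0`). -/
def RemovesRow (i₀ : ι 0) (w : ℕ) (T : ℕ → RCData ι) (α : ℕ → ∀ a, Option (ι a)) : Prop :=
  (T 0).width 0 i₀ = w ∧ ∀ k < w, KKRStep (T k) i₀ (α k) (T (k + 1))

/-- `S'` results from `S` by removing the rows in the list from the quantum space by the KKR
procedure, in the order of the list, and none of the rows of `μ^(1)` is singular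
at any moment when a box is going to be removed. -/
inductive RemovesNonsingular : List (ι 0) → RCData ι → RCData ι → Prop
  | nil (S : RCData ι) : RemovesNonsingular [] S S
  | next (i : ι 0) (o : List (ι 0)) (S S' : RCData ι) :
      S.width 0 i = 0 → RemovesNonsingular o S S' → RemovesNonsingular (i :: o) S S'
  | box (i : ι 0) (o : List (ι 0)) (S S₁ S' : RCData ι) (α : ∀ a, Option (ι a)) :
      (∀ r, ¬ S.Singular 1 r) → KKRStep S i α S₁ →
      RemovesNonsingular (i :: o) S₁ S' → RemovesNonsingular (i :: o) S S'

open Classical in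
/-- The set of those `k < w` such that the `k`-th removal (see `RemovesRow`) takes away a box
of `μ^(2)` in a column `≤ M`. -/
noncomputable def removalsUpTo (w M : ℕ) (T : ℕ → RCData ι) (α : ℕ → ∀ a, Option (ι a)) :
    Finset ℕ :=
  (Finset.range w).filter fun k => ∃ i : ι 2, α k 2 = some i ∧ (T k).width 2 i ≤ M

end General

section Plus

variable {ι : ℕ → Type}

/-- Labels of the rows of the modified rigged configuration: its quantum space
is `μ^(0) ∪ μ^(1) ∪ (1^L)`. -/
def PlusIdx (ι : ℕ → Type) (L : ℕ) : ℕ → Type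
  | 0 => ι 0 ⊕ (ι 1 ⊕ Fin L)
  | a + 1 => ι (a + 1)

instance instFintypePlusIdx [∀ a, Fintype (ι a)] (L : ℕ) : ∀ a, Fintype (PlusIdx ι L a)
  | 0 => inferInstanceAs (Fintype (ι 0 ⊕ (ι 1 ⊕ Fin L)))
  | a + 1 => inferInstanceAs (Fintype (ι (a + 1)))

/-- A row of the part `μ^(0)` of the modified quantum space. -/
def oldRow (L : ℕ) (i : ι 0) : PlusIdx ι L 0 := Sum.inl i

/-- A row of the part `μ^(1)` of the modified quantum space. -/
def copyRow (L : ℕ) (i : ι 1) : PlusIdx ι L 0 := Sum.inr (Sum.inl i)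

/-- A row of the part `(1^L)` of the modified quantum space. -/
def unitRow {L : ℕ} (i : Fin L) : PlusIdx ι L 0 := Sum.inr (Sum.inr i)

/-- The modified rigged configuration `RC₊`: the quantum space `μ^(0)` is replaced by
`μ^(0) ∪ μ^(1) ∪ (1^L)`, and everything else is kept. -/
def plus (S : RCData ι) (L : ℕ) : RCData (PlusIdx ι L) where
  width
    | 0 => fun i => Sum.elim (S.width 0) (Sum.elim (S.width 1) fun _ => 1) i
    | a + 1 => S.width (a + 1)
  rigging
    | 0 => fun _ => 0
    | a + 1 => S.rigging (a + 1)

/-- One round of the KKR normal ordering, starting at `S`.  First boxes of the part `(1^L)` of the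
quantum space are removed one by one until some row of `μ^(1)` is singular; this
gives `T 0`.  Then one of the singular rows `r` of `μ^(1)`, of width `w`, is chosen, and the
corresponding row (of the same width) of the part `μ^(1)` of the quantum space is removed
by the KKR procedure, with intermediate data `T k` and choices of boxes `α k`.
After the round, the data is `T w`. -/
def NormalOrderingRound [∀ a, Fintype (ι a)] {L : ℕ} (S : RCData (PlusIdx ι L)) (w : ℕ)
    (T : ℕ → RCData (PlusIdx ι L)) (α : ℕ → ∀ a, Option (PlusIdx ι L a)) : Prop :=
  ∃ (o : List (Fin L)) (r : PlusIdx ι L 1) (q : ι 1),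
    RemovesNonsingular (o.map unitRow) S (T 0) ∧
    (T 0).Singular 1 r ∧ (T 0).width 1 r = w ∧
    RemovesRow (copyRow L q) w T α

end Plus

end RCData

/-- A system of unwinding pairs of a tensor product `B ⊗ A` of one-row tableaux, where
`b 0, …, b (M - 1)` are the letters of `B` and `a 0, …, a (L - 1)` those of `A`: a set of
pairs `(p, q)`, connecting the dot of the `p`-th letter of `B` (left column) with the dot of the
`q`-th letter of `A` (right column), such that every dot is connected at most once and the
left dot is in a strictly higher row of the diagram than the right one, i.e. `b p < a q`. -/
structure IsUnwindingSystem (M L : ℕ) (b a : ℕ → ℕ) (P : Finset (ℕ × ℕ)) : Prop where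
  mem_left : ∀ x ∈ P, x.1 < M
  mem_right : ∀ x ∈ P, x.2 < L
  left_inj : ∀ x ∈ P, ∀ y ∈ P, x.1 = y.1 → x = y
  right_inj : ∀ x ∈ P, ∀ y ∈ P, x.2 = y.2 → x = y
  unwinding : ∀ x ∈ P, b x.1 < a x.2

/-!
For a choice of boxes write `c^(a)` for the column of the box chosen at level `a`, with `c^(a) = ⊤` if
there is none; then `c^(a) ≤ c^(a+1)`.  A step of the procedure changes the vacancy number
`p^(a)_j` by `-1` for `c^(a-1) ≤ j < c^(a)`, by `+1` for `c^(a) ≤ j < c^(a+1)`, and not at all for other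
`j` (`vacancy_remove`).  A row whose vacancy number drops was not singular, so riggings never
exceed vacancy numbers (`CoquantumGE.zero_remove`).  While one row of the quantum space is removed,
a row that was just shortened is singular, so the columns strictly decrease at each level
(`RemovesRow.exists_width_lt`); this gives the monotonicity of the letters and `m ≤ |B|`.

The strict inequality of letters follows from `col_le_col`: if `α_i` are those choices during the
removal of `A` that take a box of `μ^(2)` in a column `≤ |B|` away, and `β_i` the choices during
the removal of `B`, and `α_i^(a)`, `β_i^(a)` denote the columns of the chosen boxes, then
`α_i^(a+1) ≤ β_i^(a)` for `a ≥ 1`, so the chain of `β_i` ends at least one level earlier.  For `a = 1` it holds because `α_i^(2) ≤ |B| - i ≤ β_i^(1)`, counting `i` from `0`.  Given the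
inequality at level `a - 1`, it suffices that no row of `μ^(a)` of width `j` with
`α_i^(a) ≤ j < α_i^(a+1)` is singular when `β_i` is chosen.  Each choice up to `α_i` whose column at
level `a` is `≤ j` raises `p^(a)_j` by one (`RemovesRow.coquantumGE_count`), later choices for `A` do
not lower it, and a choice `β_k` with `k < i` lowers it, by one, only if `β_k^(a-1) ≤ j`; then also
`α_k^(a) ≤ j`.  The raise by `α_i` itself is therefore left over.
-/

namespace RCData

section General

variable {ι : ℕ → Type}

/-- The column of the box that `α` chooses at level `a`, and `⊤` if it chooses none. -/
noncomputable def col (S : RCData ι) (α : ∀ a, Option (ι a)) (a : ℕ) : ℕ∞ :=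
  (α a).elim ⊤ fun i => (S.width a i : ℕ∞)

theorem col_of_some {S : RCData ι} {α : ∀ a, Option (ι a)} {a : ℕ} {i : ι a} (h : α a = some i) :
    S.col α a = S.width a i := by
  simp [col, h]

theorem col_eq_top {S : RCData ι} {α : ∀ a, Option (ι a)} {a : ℕ} :
    S.col α a = ⊤ ↔ α a = none := by
  unfold col
  cases α a <;> simp

theorem letter_le {α : ∀ a, Option (ι a)} {a : ℕ} (h : α a = none) : letter α ≤ a := Nat.sInf_le h

theorem apply_letter {α : ∀ a, Option (ι a)} {a : ℕ} (h : α a = none) :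
    α (letter α) = none :=
  Nat.sInf_mem (s := {j | α j = none}) ⟨a, h⟩

theorem width_remove_of_some {S : RCData ι} [∀ a, Fintype (ι a)] {α : ∀ a, Option (ι a)} {a : ℕ}
    {i : ι a} (h : α a = some i) : (S.remove α).width a i = S.width a i - 1 := by
  simp [remove, shrink, h]

theorem width_remove_of_ne {S : RCData ι} [∀ a, Fintype (ι a)] {α : ∀ a, Option (ι a)} {a : ℕ}
    {i : ι a} (h : α a ≠ some i) : (S.remove α).width a i = S.width a i := by
  simp [remove, shrink, h]

theorem rigging_remove_of_ne {S : RCData ι} [∀ a, Fintype (ι a)] {α : ∀ a, Option (ι a)} {a : ℕ}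
    {i : ι a} (h : α a ≠ some i) : (S.remove α).rigging a i = S.rigging a i := by
  simp [remove, h]

theorem rigging_remove_of_some {S : RCData ι} [∀ a, Fintype (ι a)] {α : ∀ a, Option (ι a)} {a : ℕ}
    {i : ι a} (h : α a = some i) :
    (S.remove α).rigging a i = (S.remove α).vacancy a ((S.remove α).width a i) := by
  simp only [remove, h, if_true]
  rfl

/-- Every row of width `j` of `μ^(a)` has a rigging that is at least `c` below the vacancy number. -/
def CoquantumGE [∀ a, Fintype (ι a)] (S : RCData ι) (a j : ℕ) (c : ℤ) : Prop :=
  ∀ i, S.width a i = j → S.rigging a i + c ≤ S.vacancy a j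

variable [∀ a, Fintype (ι a)] {S : RCData ι} {i₀ : ι 0} {α : ∀ a, Option (ι a)}

theorem CoquantumGE.mono {a j : ℕ} {c d : ℤ} (h : S.CoquantumGE a j c) (hd : d ≤ c) :
    S.CoquantumGE a j d := fun i hi => by linarith [h i hi]

theorem IsSelection.exists_some_of_some_succ (h : S.IsSelection i₀ α) {a : ℕ} {i : ι (a + 1)}
    (hi : α (a + 1) = some i) : ∃ i', α a = some i' := by
  cases ha : α a with
  | none => simp [h.none_succ a ha] at hi
  | some i' => exact ⟨i', rfl⟩

theorem IsSelection.col_le_succ (h : S.IsSelection i₀ α) (a : ℕ) :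
    S.col α a ≤ S.col α (a + 1) := by
  cases hs : α (a + 1) with
  | none => simp [col_eq_top.2 hs]
  | some i =>
    obtain ⟨i', hi'⟩ := h.exists_some_of_some_succ hs
    rw [col_of_some hi', col_of_some hs]
    exact_mod_cast (h.next_singular a _ _ hi' hs).2

theorem IsSelection.width_pos (h : S.IsSelection i₀ α) (h₀ : 0 < S.width 0 i₀) {a : ℕ} {i : ι a}
    (hi : α a = some i) : 0 < S.width a i := by
  cases a with
  | zero => rw [h.zero] at hi; cases hi; exact h₀
  | succ a =>
    obtain ⟨i', hi'⟩ := h.exists_some_of_some_succ hi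
    exact (h.next_singular a _ _ hi' hi).1.1

/-- A selection passes over no singular row. -/
theorem IsSelection.not_singular (h : S.IsSelection i₀ α) {a : ℕ} {r : ι (a + 1)}
    (h₁ : S.col α a ≤ S.width (a + 1) r) (h₂ : (S.width (a + 1) r : ℕ∞) < S.col α (a + 1)) :
    ¬ S.Singular (a + 1) r := by
  intro hr
  cases ha : α a with
  | none => simp [col_eq_top.2 ha] at h₁
  | some i =>
    rw [col_of_some ha, Nat.cast_le] at h₁
    cases hs : α (a + 1) with
    | none => exact absurd (h.exhausted a i ha hs r hr) (by omega)
    | some i' =>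
      rw [col_of_some hs, Nat.cast_lt] at h₂
      exact absurd (h.next_shortest a i i' ha hs r hr h₁) (by omega)

open Classical in
theorem Q_remove (h : S.IsSelection i₀ α) (h₀ : 0 < S.width 0 i₀) (a j : ℕ) :
    (S.remove α).Q a j = S.Q a j - if S.col α a ≤ j then 1 else 0 := by
  cases ha : α a with
  | none =>
    have hw : (S.remove α).width a = S.width a :=
      funext fun i => width_remove_of_ne (by simp [ha])
    simp [Q, hw, col_eq_top.2 ha]
  | some i =>
    have hpos := h.width_pos h₀ ha
    unfold Q
    rw [← Finset.add_sum_erase _ _ (Finset.mem_univ i),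
      ← Finset.add_sum_erase (a := i) Finset.univ (fun i => ((min j (S.width a i) : ℕ) : ℤ))
        (Finset.mem_univ i),
      Finset.sum_congr rfl (g := fun i => ((min j (S.width a i) : ℕ) : ℤ)),
      width_remove_of_some ha, col_of_some ha]
    · simp only [Nat.cast_le]
      split_ifs <;> omega
    · intro x hx
      rw [width_remove_of_ne]
      rw [ha]
      intro e
      cases e
      simp at hx

open Classical in
theorem vacancy_remove (h : S.IsSelection i₀ α) (h₀ : 0 < S.width 0 i₀) (a j : ℕ) :
    (S.remove α).vacancy (a + 1) j = S.vacancy (a + 1) j - (if S.col α a ≤ j then 1 else 0)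
      + 2 * (if S.col α (a + 1) ≤ j then 1 else 0) - if S.col α (a + 2) ≤ j then 1 else 0 := by
  simp only [vacancy, Nat.add_sub_cancel, Q_remove h h₀]
  ring

open Classical in
/-- The condition `col ≠ j + 1` says that no row is shortened to the width `j`. -/
theorem CoquantumGE.remove (h : S.IsSelection i₀ α) (h₀ : 0 < S.width 0 i₀) {a j : ℕ} {c : ℤ}
    (hc : S.CoquantumGE (a + 1) j c) (hj : S.col α (a + 1) ≠ ((j + 1 : ℕ) : ℕ∞)) :
    (S.remove α).CoquantumGE (a + 1) j (c - (if S.col α a ≤ j then 1 else 0)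
      + 2 * (if S.col α (a + 1) ≤ j then 1 else 0) - if S.col α (a + 2) ≤ j then 1 else 0) := by
  intro i hi
  by_cases hs : α (a + 1) = some i
  · rw [width_remove_of_some hs] at hi
    have := h.width_pos h₀ hs
    rw [col_of_some hs] at hj
    exact absurd (congrArg _ (by omega)) hj
  · rw [width_remove_of_ne hs] at hi
    rw [rigging_remove_of_ne hs, vacancy_remove h h₀]
    linarith [hc i hi]

theorem CoquantumGE.remove_of_le (h : S.IsSelection i₀ α) (h₀ : 0 < S.width 0 i₀) {a j : ℕ} {c : ℤ}
    (hc : S.CoquantumGE (a + 1) j c) (hj : S.col α (a + 1) ≤ j) :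
    (S.remove α).CoquantumGE (a + 1) j c := by
  refine (hc.remove h h₀ fun e => ?_).mono ?_
  · rw [e, Nat.cast_le] at hj
    omega
  · rw [if_pos hj]
    split_ifs <;> omega

/-- A step preserves the property that riggings do not exceed vacancy numbers. -/
theorem CoquantumGE.zero_remove (h : S.IsSelection i₀ α) (h₀ : 0 < S.width 0 i₀) {a j : ℕ}
    (hj : 0 < j) (hc : S.CoquantumGE (a + 1) j 0) : (S.remove α).CoquantumGE (a + 1) j 0 := by
  intro i hi
  by_cases hs : α (a + 1) = some i
  · rw [rigging_remove_of_some hs, hi, add_zero]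
  · rw [width_remove_of_ne hs] at hi
    rw [rigging_remove_of_ne hs, vacancy_remove h h₀]
    have hle := hc i hi
    have h₂ : S.col α (a + 1) ≤ j ∨ ¬ S.col α (a + 2) ≤ j := by
      by_contra! h'
      exact absurd ((h.col_le_succ (a + 1)).trans h'.2) (not_le.2 h'.1)
    by_cases h₁ : S.col α (a + 1) ≤ j
    · rw [if_pos h₁]
      split_ifs <;> omega
    · rw [if_neg h₁, if_neg (h₂.resolve_left h₁)]
      split_ifs with h₃
      · have hns : ¬ S.Singular (a + 1) i :=
          h.not_singular (by rwa [hi]) (by rw [hi]; exact not_le.1 h₁)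
        have hne : S.rigging (a + 1) i ≠ S.vacancy (a + 1) j := fun e =>
          hns ⟨hi ▸ hj, by rw [hi, e]⟩
        omega
      · omega

theorem width_remove_zero (h : S.IsSelection i₀ α) :
    (S.remove α).width 0 i₀ = S.width 0 i₀ - 1 :=
  width_remove_of_some h.zero

theorem CoquantumGE.congr {S' : RCData ι} {a j : ℕ} {c : ℤ}
    (hw : ∀ b, S'.width (b + 1) = S.width (b + 1)) (hr : S'.rigging (a + 2) = S.rigging (a + 2))
    (hc : S.CoquantumGE (a + 2) j c) : S'.CoquantumGE (a + 2) j c := by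
  intro i hi
  have hQ : ∀ b, S'.Q (b + 1) j = S.Q (b + 1) j := fun b => by simp only [Q, hw b]
  rw [hw] at hi
  have := hc i hi
  simp only [vacancy, show a + 2 - 1 = a + 1 from rfl] at this ⊢
  rw [hr, hQ, hQ, hQ]
  exact this

theorem IsSelection.eq_none (h : S.IsSelection i₀ α) (hs : ∀ r, ¬ S.Singular 1 r) (a : ℕ) :
    α (a + 1) = none := by
  induction a with
  | zero =>
    cases h1 : α 1 with
    | none => rfl
    | some r => exact absurd (h.next_singular 0 _ _ h.zero h1).1 (hs r)
  | succ a ih => exact h.none_succ _ ih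

theorem RemovesNonsingular.levels_eq {o : List (ι 0)} {S S' : RCData ι}
    (h : RemovesNonsingular o S S') (a : ℕ) :
    S'.width (a + 1) = S.width (a + 1) ∧ S'.rigging (a + 1) = S.rigging (a + 1) := by
  induction h with
  | nil => exact ⟨rfl, rfl⟩
  | next i o S S' _ _ ih => exact ih
  | box i o S S₁ S' α hs hstep _ ih =>
    obtain ⟨_, hα, rfl⟩ := hstep
    have hn := hα.eq_none hs a
    rw [ih.1, ih.2]
    exact ⟨funext fun i => width_remove_of_ne (by simp [hn]),
      funext fun i => rigging_remove_of_ne (by simp [hn])⟩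

theorem RemovesNonsingular.coquantumGE {o : List (ι 0)} {S S' : RCData ι}
    (h : RemovesNonsingular o S S') {a j : ℕ} {c : ℤ} (hc : S.CoquantumGE (a + 2) j c) :
    S'.CoquantumGE (a + 2) j c :=
  hc.congr (fun b => (h.levels_eq b).1) (h.levels_eq _).2

end General

/-! ### Removal of a row of the quantum space -/

section Row

variable {ι : ℕ → Type} [∀ a, Fintype (ι a)] {i₀ : ι 0} {w : ℕ} {T : ℕ → RCData ι}
  {α : ℕ → ∀ a, Option (ι a)}

namespace RemovesRow

theorem width_zero (h : RemovesRow i₀ w T α) {k : ℕ} (hk : k ≤ w) :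
    (T k).width 0 i₀ = w - k := by
  induction k with
  | zero => exact h.1
  | succ k ih =>
    obtain ⟨_, hα, e⟩ := h.2 k hk
    rw [e, width_remove_zero hα, ih (by omega)]
    omega

theorem exists_width_succ_lt (h : RemovesRow i₀ w T α) {k : ℕ} (hk : k + 1 < w) (a : ℕ) (i : ι a)
    (hi : α k a = some i) :
    ∃ i', α (k + 1) a = some i' ∧ (T (k + 1)).width a i' < (T k).width a i := by
  obtain ⟨h₀, hα, e⟩ := h.2 k (by omega)
  obtain ⟨h₀', hα', -⟩ := h.2 (k + 1) hk
  induction a with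
  | zero =>
    rw [hα.zero] at hi
    cases hi
    exact ⟨i₀, hα'.zero, by rw [h.width_zero hk.le, h.width_zero (by omega)]; omega⟩
  | succ a ih =>
    obtain ⟨r, hr⟩ := hα.exists_some_of_some_succ hi
    obtain ⟨r', hr', hlt⟩ := ih r hr
    have hle := (hα.next_singular a r i hr hi).2
    have hpos := hα'.width_pos h₀' hr'
    have hw : (T (k + 1)).width (a + 1) i = (T k).width (a + 1) i - 1 := by
      rw [e, width_remove_of_some hi]
    -- The row that was just shortened is singular and wide enough to be chosen.
    have hsing : (T (k + 1)).Singular (a + 1) i :=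
      ⟨by omega, by rw [e]; exact rigging_remove_of_some hi⟩
    cases hs : α (k + 1) (a + 1) with
    | none => exact absurd (hα'.exhausted a r' hr' hs i hsing) (by omega)
    | some i' =>
      exact ⟨i', rfl, by have := hα'.next_shortest a r' i' hr' hs i hsing (by omega); omega⟩

/-- At each level, the columns of the chosen boxes strictly decrease. -/
theorem exists_width_lt (h : RemovesRow i₀ w T α) {k l : ℕ} (hkl : k < l) (hl : l < w) {a : ℕ}
    {i : ι a} (hi : α k a = some i) :
    ∃ i', α l a = some i' ∧ (T l).width a i' < (T k).width a i := by
  induction l, hkl using Nat.le_induction with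
  | base => exact h.exists_width_succ_lt hl a i hi
  | succ l _ ih =>
    obtain ⟨i', hi', hlt⟩ := ih (by omega)
    obtain ⟨i'', hi'', hlt'⟩ := h.exists_width_succ_lt hl a i' hi'
    exact ⟨i'', hi'', hlt'.trans hlt⟩

theorem col_add_one_le (h : RemovesRow i₀ w T α) {k l : ℕ} (hkl : k < l) (hl : l < w) (a : ℕ) :
    (T l).col (α l) a + 1 ≤ (T k).col (α k) a := by
  cases hk : α k a with
  | none => simp [col_eq_top.2 hk]
  | some i =>
    obtain ⟨i', hi', hlt⟩ := h.exists_width_lt hkl hl hk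
    rw [col_of_some hi', col_of_some hk]
    exact_mod_cast hlt

theorem col_anti (h : RemovesRow i₀ w T α) {k l : ℕ} (hkl : k ≤ l) (hl : l < w) (a : ℕ) :
    (T l).col (α l) a ≤ (T k).col (α k) a := by
  rcases hkl.eq_or_lt with rfl | hlt
  · exact le_rfl
  · exact le_self_add.trans (h.col_add_one_le hlt hl a)

theorem letter_mono (h : RemovesRow i₀ w T α) {N : ℕ} (hN : IsEmpty (ι N)) {k l : ℕ}
    (hkl : k ≤ l) (hl : l < w) : letter (α k) ≤ letter (α l) := by
  have hn : α l (letter (α l)) = none :=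
    apply_letter (a := N) (by cases h' : α l N with
      | none => rfl
      | some i => exact hN.elim i)
  refine letter_le ?_
  have := h.col_anti hkl hl (letter (α l))
  rw [col_eq_top.2 hn, top_le_iff, col_eq_top] at this
  exact this

theorem coquantumGE_zero (h : RemovesRow i₀ w T α) {a j : ℕ} (hj : 0 < j)
    (h₀ : (T 0).CoquantumGE (a + 1) j 0) {k : ℕ} (hk : k ≤ w) :
    (T k).CoquantumGE (a + 1) j 0 := by
  induction k with
  | zero => exact h₀
  | succ k ih =>
    obtain ⟨hpos, hα, e⟩ := h.2 k hk
    rw [e]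
    exact (ih (by omega)).zero_remove hα hpos hj

open Classical in
/-- As long as the columns at level `a + 2` are `> j`, each choice whose column at level `a + 1`
is `≤ j` raises the vacancy number at `j` by one. -/
theorem coquantumGE_count (h : RemovesRow i₀ w T α) {a j l : ℕ} (hj : 0 < j)
    (h₀ : (T 0).CoquantumGE (a + 1) j 0) (hl : l < w)
    (hlt : (j : ℕ∞) < (T l).col (α l) (a + 2)) {k : ℕ} (hk : k ≤ l + 1) :
    (T k).CoquantumGE (a + 1) j
      ((Finset.range k).filter fun k' => (T k').col (α k') (a + 1) ≤ j).card := by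
  induction k with
  | zero => simpa using h₀
  | succ k ih =>
    by_cases hc : (T k).col (α k) (a + 1) ≤ j
    · obtain ⟨hpos, hα, e⟩ := h.2 k (by omega)
      have hgt : ¬ (T k).col (α k) (a + 2) ≤ j :=
        not_le.2 (hlt.trans_le (h.col_anti (by omega) hl _))
      rw [e]
      refine ((ih (by omega)).remove hα hpos fun e' => ?_).mono ?_
      · rw [e', Nat.cast_le] at hc
        omega
      · rw [if_pos ((hα.col_le_succ a).trans hc), if_pos hc, if_neg hgt, Finset.range_add_one,
          Finset.filter_insert, if_pos hc, Finset.card_insert_of_notMem (by simp)]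
        push_cast
        linarith
    · -- The columns decrease, so no choice has been counted so far.
      rw [Finset.filter_false_of_mem]
      · simpa using h.coquantumGE_zero hj h₀ (k := k + 1) (by omega)
      · intro k' hk' hle
        exact hc ((h.col_anti (by simpa [Nat.lt_succ_iff] using hk') (by omega) _).trans hle)

theorem coquantumGE_of_le (h : RemovesRow i₀ w T α) {a j l : ℕ} {c : ℤ}
    (hle : (T l).col (α l) (a + 1) ≤ j) (hc : (T (l + 1)).CoquantumGE (a + 1) j c) {k : ℕ}
    (hlk : l + 1 ≤ k) (hk : k ≤ w) : (T k).CoquantumGE (a + 1) j c := by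
  induction k, hlk using Nat.le_induction with
  | base => exact hc
  | succ k hlk ih =>
    obtain ⟨hpos, hα, e⟩ := h.2 k hk
    rw [e]
    exact (ih (by omega)).remove_of_le hα hpos ((h.col_anti (by omega) (by omega) _).trans hle)

end RemovesRow

end Row

/-! ### Comparison of the removals of two rows -/

section TwoRows

variable {ι : ℕ → Type} [∀ a, Fintype (ι a)] {iA iB : ι 0} {wA wB m : ℕ} {T U : ℕ → RCData ι}
  {α β : ℕ → ∀ a, Option (ι a)} {κ : Fin m → ℕ}

open Classical in
/-- When `β i` is chosen, no row of width `j` is singular: of the unit raises of the vacancy number at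
`j` by choices for `A`, at least one more has occurred than the choices `β k`, `k < i`, have used up. -/
theorem coquantumGE_one (hA : RemovesRow iA wA T α) (hB : RemovesRow iB wB U β)
    (hκ : StrictMono κ) (hlt : ∀ i, κ i < wA) (hm : m ≤ wB) {a j : ℕ} (hj : 0 < j)
    (h₀ : (T 0).CoquantumGE (a + 1) j 0)
    (hTU : ∀ c, (T wA).CoquantumGE (a + 1) j c → (U 0).CoquantumGE (a + 1) j c)
    {i : Fin m} (hle : (T (κ i)).col (α (κ i)) (a + 1) ≤ j)
    (hgt : (j : ℕ∞) < (T (κ i)).col (α (κ i)) (a + 2))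
    (ihA : ∀ k : Fin m, (T (κ k)).col (α (κ k)) (a + 1) ≤ (U k).col (β k) a)
    (ihB : ∀ k < i, (T (κ k)).col (α (κ k)) (a + 2) ≤ (U k).col (β k) (a + 1)) :
    (U i).CoquantumGE (a + 1) j 1 := by
  set P := (Finset.range (κ i + 1)).filter fun k => (T k).col (α k) (a + 1) ≤ j with hP
  let R : ℕ → Finset ℕ := fun k => (Finset.range k).filter fun k' => (U k').col (β k') a ≤ j
  have hstart : (U 0).CoquantumGE (a + 1) j P.card :=
    hTU _ (hA.coquantumGE_of_le hle (hA.coquantumGE_count hj h₀ (hlt i) hgt le_rfl) (hlt i) le_rfl)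
  have hmain : ∀ k, k ≤ (i : ℕ) → (U k).CoquantumGE (a + 1) j (P.card - (R k).card) := by
    intro k hk
    induction k with
    | zero => simpa [R] using hstart
    | succ k ih =>
      obtain ⟨hpos, hβ, e⟩ := hB.2 k (by omega)
      let k' : Fin m := ⟨k, by omega⟩
      have hki : k' < i := Fin.lt_def.2 hk
      have hbig : ((j + 1 : ℕ) : ℕ∞) < (U k).col (β k) (a + 1) := by
        refine lt_of_lt_of_le ?_
          ((hA.col_add_one_le (hκ hki) (hlt i) (a + 2)).trans (ihB k' hki))
        push_cast
        exact (ENat.add_lt_add_iff_right (by simp)).2 hgt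
      have hbig' : (j : ℕ∞) < (U k).col (β k) (a + 1) :=
        lt_of_le_of_lt (by simp) hbig
      rw [e]
      refine ((ih (by omega)).remove hβ hpos hbig.ne').mono ?_
      rw [if_neg (not_le.2 hbig'),
        if_neg (not_le.2 (hbig'.trans_le (hβ.col_le_succ _)))]
      simp only [R, Finset.range_add_one, Finset.filter_insert]
      split_ifs
      · rw [Finset.card_insert_of_notMem (by simp)]
        push_cast
        linarith
      · linarith
  refine (hmain i le_rfl).mono ?_
  -- `κ` maps the counted choices for `B` to counted choices for `A` other than the `κ i`-th.
  have hcard : (R i).card ≤ (P.erase (κ i)).card := by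
    refine Finset.card_le_card_of_injOn (fun k => if hk : k < m then κ ⟨k, hk⟩ else 0) ?_ ?_
    · intro k hk
      obtain ⟨hki, hkj⟩ := Finset.mem_filter.1 (Finset.mem_coe.1 hk)
      have hki' : k < i := Finset.mem_range.1 hki
      have hkm : k < m := hki'.trans i.2
      have hκk : κ ⟨k, hkm⟩ < κ i := hκ (Fin.lt_def.2 hki')
      simp only [hkm, dif_pos, Finset.coe_erase, Set.mem_sdiff, Finset.mem_coe, hP,
        Finset.mem_filter, Finset.mem_range, Set.mem_singleton_iff]
      exact ⟨⟨by omega, (ihA ⟨k, hkm⟩).trans hkj⟩, by omega⟩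
    · intro k hk l hl hkl
      have hkm : k < m := (Finset.mem_range.1 (Finset.mem_filter.1 hk).1).trans i.2
      have hlm : l < m := (Finset.mem_range.1 (Finset.mem_filter.1 hl).1).trans i.2
      simp only [hkm, hlm, dif_pos] at hkl
      exact congrArg Fin.val (hκ.injective hkl)
  have hmem : κ i ∈ P := by simp [hP, hle]
  rw [Finset.card_erase_of_mem hmem] at hcard
  have := Finset.card_pos.2 ⟨_, hmem⟩
  omega

/-- The boxes chosen for `B` lie weakly to the right of the boxes that the matching choices for `A`
take at the next level. -/
theorem col_le_col (hA : RemovesRow iA wA T α) (hB : RemovesRow iB wB U β)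
    (hκ : StrictMono κ) (hlt : ∀ i, κ i < wA) (hm : m ≤ wB)
    (h₀ : ∀ a j, 0 < j → (T 0).CoquantumGE (a + 2) j 0)
    (hTU : ∀ a j c, (T wA).CoquantumGE (a + 2) j c → (U 0).CoquantumGE (a + 2) j c)
    (hbase : ∀ i : Fin m, (T (κ i)).col (α (κ i)) 2 ≤ ((wB - i : ℕ) : ℕ∞)) (a : ℕ) (i : Fin m) :
    (T (κ i)).col (α (κ i)) (a + 2) ≤ (U i).col (β i) (a + 1) := by
  induction a generalizing i with
  | zero =>
    obtain ⟨-, hβ, -⟩ := hB.2 i (by omega)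
    refine (hbase i).trans (le_trans ?_ (hβ.col_le_succ 0))
    rw [col_of_some hβ.zero, hB.width_zero (by omega)]
  | succ a iha =>
    induction i using WellFoundedLT.induction with
    | ind i ihi =>
      obtain ⟨hpos, hβ, -⟩ := hB.2 i (by omega)
      by_contra! hcon
      cases hs : β i (a + 2) with
      | none => simp [col_eq_top.2 hs] at hcon
      | some r =>
        obtain ⟨r', hr'⟩ := hβ.exists_some_of_some_succ hs
        have hsing := (hβ.next_singular _ _ _ hr' hs).1
        rw [col_of_some hs] at hcon
        have hle : (T (κ i)).col (α (κ i)) (a + 2) ≤ (U i).width (a + 2) r := by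
          rw [← col_of_some hs]
          exact (iha i).trans (hβ.col_le_succ _)
        have := coquantumGE_one hA hB hκ hlt hm hsing.1 (h₀ a _ hsing.1) (hTU a _) hle hcon
          iha ihi r rfl
        linarith [hsing.2]

end TwoRows

theorem IsRiggedConfiguration.coquantumGE_plus {ι : ℕ → Type} [∀ a, Fintype (ι a)] {n : ℕ}
    {S : RCData ι} (hS : S.IsRiggedConfiguration n) (L a j : ℕ) :
    (S.plus L).CoquantumGE (a + 2) j 0 := by
  rintro i rfl
  rw [add_zero]
  exact hS.rigging_le (a + 2) (by omega) i

end RCData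

open RCData in
theorem proposition5p1 {ι : ℕ → Type} [∀ a, Fintype (ι a)] (n : ℕ) (S : RCData ι)
    (hS : S.IsRiggedConfiguration n) (L : ℕ)
    -- the part `μ^(0)` is removed first, in any order; `L` is so large that no row of
    -- `μ^(1)` is singular in the meantime
    (o : List (ι 0)) (hnodup : o.Nodup) (hall : ∀ i, i ∈ o)
    (S₁ : RCData (RCData.PlusIdx ι L))
    (hS₁ : RCData.RemovesNonsingular (o.map (RCData.oldRow L)) (S.plus L) S₁)
    -- the first round of the normal ordering removes a row `A`, of width `wA`
    (wA : ℕ) (T : ℕ → RCData (RCData.PlusIdx ι L))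
    (α : ℕ → ∀ a, Option (RCData.PlusIdx ι L a))
    (hA : RCData.NormalOrderingRound S₁ wA T α)
    -- the second round removes a row `B`, of width `wB`
    (wB : ℕ) (U : ℕ → RCData (RCData.PlusIdx ι L))
    (β : ℕ → ∀ a, Option (RCData.PlusIdx ι L a))
    (hB : RCData.NormalOrderingRound (T wA) wB U β)
    -- the removals during which `A` takes a box of `μ^(2)` in a column `≤ |B|` away, in order
    (m : ℕ) (κ : Fin m → ℕ) (hκ : StrictMono κ)
    (hrange : Set.range κ = (RCData.removalsUpTo wA wB T α : Set ℕ)) :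
    m ≤ wB ∧
    (∀ i j : Fin m, i ≤ j → RCData.letter (α (κ i)) ≤ RCData.letter (α (κ j))) ∧
    (∀ i j : ℕ, i ≤ j → j < wB → RCData.letter (β i) ≤ RCData.letter (β j)) ∧
    (∀ i : Fin m, RCData.letter (β i) < RCData.letter (α (κ i))) ∧
    IsUnwindingSystem wB wA (fun k => RCData.letter (β k)) (fun k => RCData.letter (α k))
      (Finset.univ.image fun i : Fin m => ((i : ℕ), κ i)) := by
  obtain ⟨oA, _, qA, hSA, _, _, hA⟩ := hA
  obtain ⟨oB, _, qB, hSB, _, _, hB⟩ := hB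
  have hempty : IsEmpty (PlusIdx ι L (n + 1)) := hS.isEmpty_of_le (n + 1) (by omega)
  have hmem : ∀ i, κ i < wA ∧ ∃ r : PlusIdx ι L 2, α (κ i) 2 = some r ∧
      (T (κ i)).width 2 r ≤ wB := by
    intro i
    have : κ i ∈ (removalsUpTo wA wB T α : Set ℕ) := hrange ▸ Set.mem_range_self i
    simpa [removalsUpTo] using this
  have hlt := fun i => (hmem i).1
  -- The columns at level `2` strictly decrease, are positive, and the first one is `≤ wB`.
  have hcol : ∀ (k : ℕ) (hk : k < m) (r : PlusIdx ι L 2), α (κ ⟨k, hk⟩) 2 = some r →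
      (T (κ ⟨k, hk⟩)).width 2 r + k ≤ wB := by
    intro k
    induction k with
    | zero =>
      intro hk r hr
      obtain ⟨r', hr', hle⟩ := (hmem ⟨0, hk⟩).2
      rw [hr] at hr'
      cases hr'
      exact hle
    | succ k ih =>
      intro hk r hr
      obtain ⟨r', hr', -⟩ := (hmem ⟨k, by omega⟩).2
      obtain ⟨r'', hr'', hw⟩ := hA.exists_width_lt
        (hκ (show (⟨k, by omega⟩ : Fin m) < ⟨k + 1, hk⟩ from Fin.lt_def.2 (Nat.lt_succ_self k)))
        (hlt _) hr'
      rw [hr] at hr''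
      cases hr''
      have := ih (by omega) r' hr'
      omega
  have hm : m ≤ wB := by
    by_contra! hcon
    obtain ⟨r, hr, -⟩ := (hmem ⟨wB, hcon⟩).2
    obtain ⟨hpos, hα, -⟩ := hA.2 _ (hlt ⟨wB, hcon⟩)
    have := hα.width_pos hpos hr
    have := hcol wB hcon r hr
    omega
  have hbase : ∀ i : Fin m, (T (κ i)).col (α (κ i)) 2 ≤ ((wB - i : ℕ) : ℕ∞) := by
    intro i
    obtain ⟨r, hr, -⟩ := (hmem i).2
    rw [col_of_some hr, Nat.cast_le]
    have : (T (κ i)).width 2 r + i ≤ wB := hcol i i.2 r hr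
    omega
  have hmain := col_le_col hA hB hκ hlt hm
    (fun a j _ => hSA.coquantumGE (hS₁.coquantumGE (hS.coquantumGE_plus L a j)))
    (fun a j c => hSB.coquantumGE) hbase
  have hbA : ∀ i : Fin m, letter (β i) < letter (α (κ i)) := by
    intro i
    have hn : α (κ i) (letter (α (κ i))) = none :=
      apply_letter (a := n + 1) (by cases h' : α (κ i) (n + 1) with
        | none => rfl
        | some r => exact hempty.elim r)
    obtain ⟨r, hr, -⟩ := (hmem i).2
    obtain ⟨-, hα, -⟩ := hA.2 _ (hlt i)
    generalize letter (α (κ i)) = x at hn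
    -- A box of `μ^(2)` is chosen, so the letter is at least `3`.
    match x, hn with
    | 0, hn => exact absurd (hα.none_succ 1 (hα.none_succ 0 hn)) (by simp [hr])
    | 1, hn => exact absurd (hα.none_succ 1 hn) (by simp [hr])
    | x + 2, hn =>
      have := hmain x i
      rw [col_eq_top.2 hn, top_le_iff, col_eq_top] at this
      exact Nat.lt_succ_of_le (letter_le this)
  refine ⟨hm, fun i j hij => hA.letter_mono hempty (hκ.monotone hij) (hlt j),
    fun i j hij hj => hB.letter_mono hempty hij hj, hbA, ?_⟩
  constructor
  · simp only [Finset.mem_image, Finset.mem_univ, true_and]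
    rintro _ ⟨i, rfl⟩
    exact i.2.trans_le hm
  · simp only [Finset.mem_image, Finset.mem_univ, true_and]
    rintro _ ⟨i, rfl⟩
    exact hlt i
  · simp only [Finset.mem_image, Finset.mem_univ, true_and]
    rintro _ ⟨i, rfl⟩ _ ⟨j, rfl⟩ h
    rw [Fin.ext h]
  · simp only [Finset.mem_image, Finset.mem_univ, true_and]
    rintro _ ⟨i, rfl⟩ _ ⟨j, rfl⟩ h
    rw [hκ.injective h]
  · simp only [Finset.mem_image, Finset.mem_univ, true_and]
    rintro _ ⟨i, rfl⟩
    exact hbA i
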